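/- Let $\mathbb K=\mathbb R$ or $\mathbb C$, and let $\mathcal P_n$ be the open cone of positive definite symmetric (resp. Hermitian) $n\times n$ matrices over $\mathbb K$, on which $GL_n(\mathbb K)$ acts by $A\cdot S=ASA^*$; this identifies $\mathcal P_n$ with the symmetric space $GL_n(\mathbb R)/O_n$ (resp. $GL_n(\mathbb C)/U_n$) through $A\mapsto AA^*$. Let $\mathfrak a$ be the space of diagonal matrices over $\mathbb K$ of trace $0$, let $\tilde{\mathfrak a}=\mathbb K\cdot \mathrm{Id}_n+\mathfrak a\subset\mathfrak{gl}_n(\mathbb K)$, and let $\mathscr F\subset\mathcal P_n$ be the image of $\exp\tilde{\mathfrak a}$ in the symmetric space, i.e. $\mathscr F=\{AA^*\mid A\in\exp\tilde{\mathfrak a}\}$. Then: (1) The sum $\tilde{\mathfrak a}=\mathbb K\cdot\mathrm{Id}_n\oplus\mathfrak a$ is direct, $\mathfrak a$ is a Cartan subalgebra of $\mathfrak{sl}_n(\mathbb K)$ and $\tilde{\mathfrak a}$ is a Cartan subalgebra of $\mathfrak{gl}_n(\mathbb K)$. As a set of matrices, $\mathscr F=\{\exp X\mid X\in\tilde{\mathfrak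 a},\,X^*=X\}$; in particular $\mathscr F=\exp\tilde{\mathfrak a}$ if $\mathbb K=\mathbb R$. (2) The formula $g_S(X,Y)=\operatorname{Re}\operatorname{tr}(S^{-1}XS^{-1}Y)$ defines a $GL_n(\mathbb K)$-invariant Riemannian metric on $\mathcal P_n$; and for every $GL_n(\mathbb K)$-invariant Riemannian metric on $\mathcal P_n$, $\mathscr F$ is an embedded $n$-dimensional submanifold which is totally geodesic (every geodesic of $\mathcal P_n$ tangent to $\mathscr F$ at one point lies in $\mathscr F$) and flat (the Riemann curvature tensor of the induced metric vanishes). (3) $\mathscr F$ parametrizes the interior of every diagospectrahedron: let $Q(x)=Q_0+\sum_{i=1}^m x_iQ_i$, $x\in\mathbb R^m$, with $Q_0,\dots,Q_m$ diagonal symmetric (resp. Hermitian) matrices, such that $Q(x)$ is positive definite for at least one $x$, and let $\Sigma=\{x\in\mathbb R^m\mid Q(x)\text{ is positive semidefinite}\}$. Then $\operatorname{int}\Sigma=\{x\mid Q(x)\in\mathscr F\}$ and $Q(\operatorname{int}\Sigma)=\mathscr F\cap Q(\mathbb R^m)$; if $Q_1,\dots,Q_m$ are linearly independent over $\mathbb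 R$, then $Q$ is injective, and if moreover $Q(\mathbb R^m)$ contains all diagonal symmetric (resp. Hermitian) matrices, $Q$ maps $\operatorname{int}\Sigma$ bijectively onto $\mathscr F$. -/

import Mathlib

open Set Filter Topology
open scoped ContDiff Matrix ComplexOrder

/-! ### Riemannian geometry of open subsets of a finite-dimensional real vector space -/

section RiemannianGeometry

variable {E : Type*} [NormedAddCommGroup E] [NormedSpace ℝ E]

/-- `g` restricts to a smooth Riemannian metric on the open set `Ω`; the value `g x` is the
inner product on the tangent space `T_x Ω = E`. -/
structure IsRiemannianMetricOn (Ω : Set E) (g : E → E →L[ℝ] E →L[ℝ] ℝ) : Prop where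
  smooth : ContDiffOn ℝ ∞ g Ω
  symm : ∀ x ∈ Ω, ∀ u v : E, g x u v = g x v u
  pos : ∀ x ∈ Ω, ∀ u : E, u ≠ 0 → 0 < g x u u

/-- The Christoffel symbols of the Levi-Civita connection of `g`, in the linear coordinates of `E`:
`christoffel g x u v` is the vector `z` with
`g x z w = (D_u g (v, w) + D_v g (u, w) - D_w g (u, v)) / 2` for all `w`. -/
noncomputable def christoffel (g : E → E →L[ℝ] E →L[ℝ] ℝ) (x u v : E) : E :=
  (g x).inverse ((1 / 2 : ℝ) •
    (fderiv ℝ g x u v + fderiv ℝ g x v u - ((fderiv ℝ g x).flip u).flip v))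

/-- The Riemann curvature tensor `R_x(u, v) w` of the Levi-Civita connection of `g`. -/
noncomputable def riemannCurvature (g : E → E →L[ℝ] E →L[ℝ] ℝ) (x u v w : E) : E :=
  fderiv ℝ (fun y => christoffel g y v w) x u - fderiv ℝ (fun y => christoffel g y u w) x v
    + christoffel g x u (christoffel g x v w) - christoffel g x v (christoffel g x u w)

/-- `γ` restricts to a geodesic `(a, b) → Ω` of the metric `g`. -/
structure IsGeodesicOn (Ω : Set E) (g : E → E →L[ℝ] E →L[ℝ] ℝ) (γ : ℝ → E) (a b : ℝ) :
    Prop where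
  mem : ∀ t ∈ Ioo a b, γ t ∈ Ω
  smooth : ContDiffOn ℝ ∞ γ (Ioo a b)
  equation : ∀ t ∈ Ioo a b,
    deriv (deriv γ) t + christoffel g (γ t) (deriv γ t) (deriv γ t) = 0

/-- `f` restricts to a smooth embedding of the open set `U ⊆ ℝᵏ` onto a relatively open subset
of `F`. -/
structure IsLocalParametrization {k : ℕ} (F : Set E) (f : EuclideanSpace ℝ (Fin k) → E)
    (U : Set (EuclideanSpace ℝ (Fin k))) : Prop where
  isOpen : IsOpen U
  smooth : ContDiffOn ℝ ∞ f U
  immersion : ∀ x ∈ U, Function.Injective (fderiv ℝ f x)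
  image_eq : ∃ V : Set E, IsOpen V ∧ f '' U = F ∩ V
  inverse : ∃ h : E → EuclideanSpace ℝ (Fin k), ContinuousOn h (f '' U) ∧ LeftInvOn h f U

/-- `F` is an embedded smooth submanifold of dimension `k`. -/
def IsSubmanifold (k : ℕ) (F : Set E) : Prop :=
  ∀ p ∈ F, ∃ (f : EuclideanSpace ℝ (Fin k) → E) (U : Set (EuclideanSpace ℝ (Fin k))),
    IsLocalParametrization F f U ∧ p ∈ f '' U

/-- The tangent space of the submanifold `F` at `p`: velocities of smooth curves in `F`. -/
def tangentVectors (F : Set E) (p : E) : Set E :=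
  {v | ∃ c : ℝ → E, c 0 = p ∧ ContDiffAt ℝ ∞ c 0 ∧ (∀ᶠ t in 𝓝 0, c t ∈ F) ∧ deriv c 0 = v}

/-- `F` is a totally geodesic subset of `(Ω, g)`: every geodesic of `(Ω, g)` which is tangent to
`F` at some time is a curve in `F`. -/
def IsTotallyGeodesic (Ω : Set E) (g : E → E →L[ℝ] E →L[ℝ] ℝ) (F : Set E) : Prop :=
  F ⊆ Ω ∧ ∀ (γ : ℝ → E) (a b : ℝ), IsGeodesicOn Ω g γ a b →
    ∀ s ∈ Ioo a b, γ s ∈ F → deriv γ s ∈ tangentVectors F (γ s) → ∀ t ∈ Ioo a b, γ t ∈ F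

/-- The pull-back of the metric `g` under `f`. -/
noncomputable def pullbackMetric {W : Type*} [NormedAddCommGroup W] [NormedSpace ℝ W]
    (g : E → E →L[ℝ] E →L[ℝ] ℝ) (f : W → E) (x : W) : W →L[ℝ] W →L[ℝ] ℝ :=
  (g (f x)).bilinearComp (fderiv ℝ f x) (fderiv ℝ f x)

/-- The `k`-dimensional submanifold `F` with the metric induced by `g` is flat: near each of its
points the Riemann curvature tensor of the induced metric vanishes. -/
def IsFlatSubmanifold (k : ℕ) (g : E → E →L[ℝ] E →L[ℝ] ℝ) (F : Set E) : Prop :=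
  ∀ p ∈ F, ∃ (f : EuclideanSpace ℝ (Fin k) → E) (U : Set (EuclideanSpace ℝ (Fin k))),
    IsLocalParametrization F f U ∧ p ∈ f '' U ∧
      ∀ x ∈ U, ∀ u v w, riemannCurvature (pullbackMetric g f) x u v w = 0

end RiemannianGeometry

/-! ### The cone of positive definite matrices as a symmetric space -/

section Cone

variable (𝕜 : Type*) [RCLike 𝕜] (n : ℕ)

/-- The real vector space of `n × n` matrices `X` over `𝕜` with `Xᴴ = X`: symmetric matrices if
`𝕜 = ℝ`, Hermitian matrices if `𝕜 = ℂ`. The matrix underlying `S : Herm 𝕜 n` is `S.1`. -/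
def Herm : Type _ := selfAdjoint.submodule ℝ (Matrix (Fin n) (Fin n) 𝕜)

/-- `Herm 𝕜 n` carries the maximum norm of the entries. It serves only to speak of smooth maps. -/
noncomputable instance : NormedAddCommGroup (Herm 𝕜 n) :=
  letI : NormedAddCommGroup (Matrix (Fin n) (Fin n) 𝕜) := Matrix.normedAddCommGroup
  inferInstanceAs (NormedAddCommGroup (selfAdjoint.submodule ℝ (Matrix (Fin n) (Fin n) 𝕜)))

noncomputable instance : NormedSpace ℝ (Herm 𝕜 n) :=
  letI : NormedAddCommGroup (Matrix (Fin n) (Fin n) 𝕜) := Matrix.normedAddCommGroup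
  letI : NormedSpace ℝ (Matrix (Fin n) (Fin n) 𝕜) := Matrix.normedSpace
  inferInstanceAs (NormedSpace ℝ (selfAdjoint.submodule ℝ (Matrix (Fin n) (Fin n) 𝕜)))

/-- The inclusion of `Herm 𝕜 n` into the space of all matrices, as a real-linear map. -/
def hermIncl : Herm 𝕜 n →ₗ[ℝ] Matrix (Fin n) (Fin n) 𝕜 where
  toFun S := S.1
  map_add' _ _ := rfl
  map_smul' _ _ := rfl

/-- The open cone of positive definite matrices. -/
def posDefCone : Set (Herm 𝕜 n) := {S | S.1.PosDef}

variable {𝕜 n}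

/-- The action `S ↦ A S Aᴴ` of `GL_n(𝕜)`. It identifies the cone of positive definite matrices with
`GL_n(ℝ)/O_n` or `GL_n(ℂ)/U_n`, by `A ↦ A Aᴴ`. -/
def congruence (A : GL (Fin n) 𝕜) (S : Herm 𝕜 n) : Herm 𝕜 n :=
  ⟨A.1 * S.1 * A.1ᴴ, Matrix.isHermitian_mul_mul_conjTranspose A.1 S.2⟩

/-- `g` is invariant on the cone of positive definite matrices under `GL_n(𝕜)`. The differential
of the action of `A` is the action of `A` itself, since this action is linear. -/
def IsInvariantMetric (g : Herm 𝕜 n → Herm 𝕜 n →L[ℝ] Herm 𝕜 n →L[ℝ] ℝ) : Prop :=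
  ∀ (A : GL (Fin n) 𝕜), ∀ S ∈ posDefCone 𝕜 n, ∀ X Y : Herm 𝕜 n,
    g (congruence A S) (congruence A X) (congruence A Y) = g S X Y

end Cone

/-! ### The Lie algebras of diagonal matrices -/

section Cartan

attribute [local instance 100] LieRing.ofAssociativeRing

variable (𝕜 : Type*) [RCLike 𝕜] (n : ℕ)

/-- The diagonal matrices of trace `0`, as a Lie subalgebra `𝔞` of `sl_n(𝕜)`. -/
def diagSL : LieSubalgebra 𝕜 (LieAlgebra.SpecialLinear.sl (Fin n) 𝕜) where
  carrier := {X | X.1.IsDiag}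
  zero_mem' := Matrix.isDiag_zero
  add_mem' hX hY := Matrix.IsDiag.add hX hY
  smul_mem' c _ hX := Matrix.IsDiag.smul c hX
  lie_mem' := by
    rintro ⟨X, _⟩ ⟨Y, _⟩ hX hY
    change (X * Y - Y * X).IsDiag
    rw [← (Matrix.isDiag_iff_diagonal_diag X).1 hX, ← (Matrix.isDiag_iff_diagonal_diag Y).1 hY]
    simp [mul_comm, Matrix.isDiag_zero]

/-- The space `𝔞` of diagonal matrices of trace `0`, inside `gl_n(𝕜)`. -/
def tracelessDiag : Submodule 𝕜 (Matrix (Fin n) (Fin n) 𝕜) :=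
  (diagSL 𝕜 n).toSubmodule.map (LieAlgebra.SpecialLinear.sl (Fin n) 𝕜).toSubmodule.subtype

theorem isDiag_of_mem_sup {X : Matrix (Fin n) (Fin n) 𝕜}
    (hX : X ∈ Submodule.span 𝕜 {1} ⊔ tracelessDiag 𝕜 n) : X.IsDiag := by
  obtain ⟨Y, hY, Z, hZ, rfl⟩ := Submodule.mem_sup.1 hX
  obtain ⟨c, rfl⟩ := Submodule.mem_span_singleton.1 hY
  obtain ⟨Z', hZ', rfl⟩ := hZ
  exact (Matrix.isDiag_one.smul c).add hZ'

/-- The Lie subalgebra `𝔞~ = 𝕜 · Id + 𝔞` of `gl_n(𝕜)`. -/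
def cartanGL : LieSubalgebra 𝕜 (Matrix (Fin n) (Fin n) 𝕜) where
  toSubmodule := Submodule.span 𝕜 {1} ⊔ tracelessDiag 𝕜 n
  lie_mem' := by
    intro X Y hX hY
    have hX := (Matrix.isDiag_iff_diagonal_diag X).1 (isDiag_of_mem_sup 𝕜 n hX)
    have hY := (Matrix.isDiag_iff_diagonal_diag Y).1 (isDiag_of_mem_sup 𝕜 n hY)
    have h : ⁅X, Y⁆ = 0 := by
      rw [← hX, ← hY, Ring.lie_def]
      simp [mul_comm]
    rw [h]
    exact Submodule.zero_mem _

/-- `H` is a Cartan subalgebra of `gl_n(𝕜)`, the Lie algebra of matrices with the commutator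
bracket. -/
def IsCartanSubalgebraOfGL {𝕜 : Type*} [RCLike 𝕜] {n : ℕ}
    (H : LieSubalgebra 𝕜 (Matrix (Fin n) (Fin n) 𝕜)) : Prop :=
  H.IsCartanSubalgebra

end Cartan

section ExpCartan

variable (𝕜 : Type*) [RCLike 𝕜] (n : ℕ)

/-- The image of `exp 𝔞~` in the symmetric space of positive definite matrices, i.e. the orbit
`{A Aᴴ | A ∈ exp 𝔞~}` of the base point `Id` (the coset of `A` corresponds to `A Aᴴ`). -/
noncomputable def expCartan : Set (Herm 𝕜 n) :=
  {S | ∃ X ∈ cartanGL 𝕜 n, S.1 = NormedSpace.exp X * (NormedSpace.exp X)ᴴ}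

end ExpCartan

/-! ### Spectrahedra -/

section Spectrahedra

variable {𝕜 : Type*} [RCLike 𝕜] {n m : ℕ}

/-- The affine pencil `Q(x) = Q₀ + x₁ Q₁ + ⋯ + x_m Q_m`. -/
noncomputable def pencil (Q₀ : Herm 𝕜 n) (Q : Fin m → Herm 𝕜 n) (x : EuclideanSpace ℝ (Fin m)) : Herm 𝕜 n :=
  Q₀ + ∑ i, x i • Q i

/-- The spectrahedron `{x ∈ ℝᵐ | Q(x) is positive semidefinite}`. -/
def spectrahedron (Q₀ : Herm 𝕜 n) (Q : Fin m → Herm 𝕜 n) : Set (EuclideanSpace ℝ (Fin m)) :=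
  {x | (pencil Q₀ Q x).1.PosSemidef}

/-- The pencil consists of diagonal matrices, i.e. its spectrahedron is a diagospectrahedron. -/
def IsDiagonalPencil (Q₀ : Herm 𝕜 n) (Q : Fin m → Herm 𝕜 n) : Prop :=
  Q₀.1.IsDiag ∧ ∀ i, (Q i).1.IsDiag

end Spectrahedra

/-!
Everything rests on the description of `expCartan 𝕜 n` as the set of diagonal positive definite
matrices (`mem_expCartan_iff_isDiag_posDef`), with the global coordinates
`expDiag : t ↦ diag (exp t₁, …, exp tₙ)` and their inverse `logDiag`.

*Cartan subalgebras.* Diagonal matrices commute, and bracketing a matrix with `E_ii - E_jj` isolates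
its `(i, j)` entry (`isDiag_of_forall_isDiag_lie`), so the diagonal matrices are self-normalizing.

*Totally geodesic.* The diagonal matrices are the common fixed points of the reflections
`S ↦ D S D`, where `D` is diagonal with one entry `-1` and the others `1`. Each of these is a linear
isometry of any invariant metric. Linear isometries preserve the Christoffel symbols, hence map
geodesics to geodesics; a geodesic that starts at a fixed point with a fixed velocity is therefore
equal to its image, by uniqueness for the geodesic equation
(`IsGeodesicOn.map_eq_self_of_isometry`). No explicit form of the metric is needed.

*Flat.* The matrices `diag (exp (tᵢ / 2))` act on the coordinates `expDiag` by translations, so an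
invariant metric has constant coefficients in them (`pullbackMetric_expDiag`).

*Trace metric.* Writing `S⁻¹ = Yᴴ Y`, the form `Re tr (S⁻¹ X S⁻¹ X)` is the squared Frobenius norm of
`Y X Yᴴ`.

*Spectrahedra.* If `Q(y)` is positive definite and `x` is interior, the segment from `y` to `x` can be
prolonged beyond `x` inside the spectrahedron, which exhibits `Q(x)` as a positive combination of
`Q(y)` and a positive semidefinite matrix (`interior_spectrahedron`).
-/

/-! ### Geodesics of Riemannian metrics on open sets -/

section Geodesics

variable {E : Type*} [NormedAddCommGroup E] [NormedSpace ℝ E]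

theorem isInvertible_of_forall_apply_self_pos [FiniteDimensional ℝ E] (B : E →L[ℝ] E →L[ℝ] ℝ)
    (hB : ∀ u, u ≠ 0 → 0 < B u u) : B.IsInvertible := by
  have hinj : Function.Injective (B : E →ₗ[ℝ] E →L[ℝ] ℝ) := by
    rw [injective_iff_map_eq_zero]
    intro u hu
    by_contra hne
    have h := hB u hne
    have hu' : B u = 0 := hu
    simp [hu'] at h
  have hrank : Module.finrank ℝ E = Module.finrank ℝ (E →L[ℝ] ℝ) := by
    rw [← (LinearMap.toContinuousLinearMap (𝕜 := ℝ) (E := E) (F' := ℝ)).finrank_eq]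
    exact Subspace.dual_finrank_eq.symm
  exact ⟨(LinearEquiv.ofInjectiveOfFinrankEq _ hinj hrank).toContinuousLinearEquiv, rfl⟩

theorem IsRiemannianMetricOn.isInvertible [FiniteDimensional ℝ E] {Ω : Set E}
    {g : E → E →L[ℝ] E →L[ℝ] ℝ} (hg : IsRiemannianMetricOn Ω g) {x : E} (hx : x ∈ Ω) :
    (g x).IsInvertible :=
  isInvertible_of_forall_apply_self_pos _ (hg.pos x hx)

theorem IsRiemannianMetricOn.contDiffAt {Ω : Set E} {g : E → E →L[ℝ] E →L[ℝ] ℝ}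
    (hg : IsRiemannianMetricOn Ω g) (hΩ : IsOpen Ω) {x : E} (hx : x ∈ Ω) : ContDiffAt ℝ ∞ g x :=
  hg.smooth.contDiffAt (hΩ.mem_nhds hx)

theorem IsRiemannianMetricOn.apply_christoffel [FiniteDimensional ℝ E] {Ω : Set E}
    {g : E → E →L[ℝ] E →L[ℝ] ℝ} (hg : IsRiemannianMetricOn Ω g) {x : E} (hx : x ∈ Ω) (u v w : E) :
    g x (christoffel g x u v) w =
      1 / 2 * (fderiv ℝ g x u v w + fderiv ℝ g x v u w - fderiv ℝ g x w u v) := by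
  unfold christoffel
  rw [(hg.isInvertible hx).self_apply_inverse]
  simp

-- needed to find the norm on the threefold space of maps in which `fderiv ℝ g x` lives
set_option maxSynthPendingDepth 3 in
/-- The Christoffel symbols depend smoothly on all their arguments; this makes the geodesic
equation an ordinary differential equation with a locally Lipschitz right-hand side. -/
theorem IsRiemannianMetricOn.contDiffAt_christoffel [FiniteDimensional ℝ E] {Ω : Set E}
    {g : E → E →L[ℝ] E →L[ℝ] ℝ} (hg : IsRiemannianMetricOn Ω g) (hΩ : IsOpen Ω) {p : E × E}
    (hp : p.1 ∈ Ω) : ContDiffAt ℝ 1 (fun q : E × E => christoffel g q.1 q.2 q.2) p := by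
  have h1 : ContDiffAt ℝ 1 (fun q : E × E => g q.1) p :=
    ((hg.contDiffAt hΩ hp).of_le (by simp)).comp p contDiffAt_fst
  have h2 : ContDiffAt ℝ 1 (fun q : E × E => fderiv ℝ g q.1) p :=
    ((hg.contDiffAt hΩ hp).fderiv_right (m := 1) (by norm_cast)).comp p contDiffAt_fst
  have h3 : ContDiffAt ℝ 1 (fun q : E × E => q.2) p := contDiffAt_snd
  have hflip : ContDiffAt ℝ 1 (fun q : E × E => ((fderiv ℝ g q.1).flip q.2).flip q.2) p := by
    have h4 : ContDiffAt ℝ 1 (fun q : E × E => (fderiv ℝ g q.1).flip q.2) p :=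
      ((ContinuousLinearMap.flipₗᵢ ℝ E E (E →L[ℝ] ℝ)).contDiff.contDiffAt.comp p h2).clm_apply h3
    exact ((ContinuousLinearMap.flipₗᵢ ℝ E E ℝ).contDiff.contDiffAt.comp p h4).clm_apply h3
  have hinv : ContDiffAt ℝ 1 (fun q : E × E => (g q.1).inverse) p := by
    obtain ⟨e, he⟩ := hg.isInvertible hp
    have : ContDiffAt ℝ 1 (ContinuousLinearMap.inverse : (E →L[ℝ] E →L[ℝ] ℝ) → _) (g p.1) :=
      he ▸ contDiffAt_map_inverse e
    exact this.comp p h1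
  unfold christoffel
  exact hinv.clm_apply ((((h2.clm_apply h3).clm_apply h3).add
    ((h2.clm_apply h3).clm_apply h3)).sub hflip |>.const_smul _)

/-- The pair `(γ, γ')` of a geodesic solves the geodesic equation written as a first-order
system. -/
theorem IsGeodesicOn.hasDerivAt_prodMk {Ω : Set E} {g : E → E →L[ℝ] E →L[ℝ] ℝ} {γ : ℝ → E}
    {a b t : ℝ} (h : IsGeodesicOn Ω g γ a b) (ht : t ∈ Ioo a b) :
    HasDerivAt (fun t => (γ t, deriv γ t))
      (deriv γ t, -christoffel g (γ t) (deriv γ t) (deriv γ t)) t := by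
  have hγ : ContDiffAt ℝ ∞ γ t := h.smooth.contDiffAt (isOpen_Ioo.mem_nhds ht)
  have h1 : HasDerivAt γ (deriv γ t) t := (hγ.differentiableAt (by simp)).hasDerivAt
  have hγ' : DifferentiableAt ℝ (deriv γ) t := by
    have : DifferentiableAt ℝ (fun s => fderiv ℝ γ s 1) t :=
      ((hγ.fderiv_right (m := 1) (by norm_cast)).differentiableAt (by simp)).clm_apply
        (differentiableAt_const _)
    simpa using this
  have h2 : HasDerivAt (deriv γ) (-christoffel g (γ t) (deriv γ t) (deriv γ t)) t := by
    rw [← eq_neg_of_add_eq_zero_left (h.equation t ht)]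
    exact hγ'.hasDerivAt
  exact h1.prodMk h2

/-- A geodesic is determined by its position and velocity at one time. -/
theorem IsGeodesicOn.eqOn [FiniteDimensional ℝ E] {Ω : Set E} (hΩ : IsOpen Ω)
    {g : E → E →L[ℝ] E →L[ℝ] ℝ} (hg : IsRiemannianMetricOn Ω g) {γ δ : ℝ → E} {a b s : ℝ}
    (hγ : IsGeodesicOn Ω g γ a b) (hδ : IsGeodesicOn Ω g δ a b) (hs : s ∈ Ioo a b)
    (h0 : γ s = δ s) (h1 : deriv γ s = deriv δ s) : EqOn γ δ (Ioo a b) := by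
  set G : ℝ → E × E := fun t => (γ t, deriv γ t) with hG
  set D : ℝ → E × E := fun t => (δ t, deriv δ t) with hD
  let V : ℝ → E × E → E × E := fun _ q => (q.2, -christoffel g q.1 q.2 q.2)
  have hGd : ∀ t ∈ Ioo a b, HasDerivAt G (V t (G t)) t := fun t ht => hγ.hasDerivAt_prodMk ht
  have hDd : ∀ t ∈ Ioo a b, HasDerivAt D (V t (D t)) t := fun t ht => hδ.hasDerivAt_prodMk ht
  -- the set of times near which the two solutions agree is open, and closed in the interval
  let u : Set ℝ := {t | G =ᶠ[𝓝 t] D}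
  have hu : IsOpen u := isOpen_setOfPred_eventually_nhds
  have hself : ∀ t ∈ u, G t = D t := fun t ht =>
    (show G =ᶠ[𝓝 t] D from ht).eq_of_nhds
  have hloc : ∀ t ∈ Ioo a b, G t = D t → t ∈ u := by
    intro t ht heq
    have hV : ContDiffAt ℝ 1 (V t) (G t) :=
      contDiffAt_snd.prodMk (hg.contDiffAt_christoffel hΩ (hγ.mem t ht)).neg
    obtain ⟨K, U, hU, hK⟩ := hV.exists_lipschitzOnWith
    have hGU : ∀ᶠ r in 𝓝 t, HasDerivAt G (V r (G r)) r ∧ G r ∈ U :=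
      ((isOpen_Ioo.eventually_mem ht).mono hGd).and ((hGd t ht).continuousAt hU)
    have hDU : ∀ᶠ r in 𝓝 t, HasDerivAt D (V r (D r)) r ∧ D r ∈ U :=
      ((isOpen_Ioo.eventually_mem ht).mono hDd).and ((hDd t ht).continuousAt (heq ▸ hU))
    exact ODE_solution_unique_of_eventually (s := fun _ => U) (Eventually.of_forall fun _ => hK)
      hGU hDU heq
  have hsub : Ioo a b ⊆ u := by
    refine isPreconnected_Ioo.subset_of_closure_inter_subset hu ⟨s, hs, hloc s hs ?_⟩ ?_
    · exact Prod.ext h0 h1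
    · rintro t ⟨htu, ht⟩
      refine hloc t ht ?_
      have hfreq : ∃ᶠ r in 𝓝 t, G r = D r :=
        (mem_closure_iff_frequently.1 htu).mono hself
      have h := (hGd t ht).continuousAt.prodMk (hDd t ht).continuousAt
      by_contra hne
      have hev := h.eventually (isClosed_diagonal.isOpen_compl.mem_nhds
        (show (G t, D t) ∈ (diagonal (E × E))ᶜ from hne))
      exact hfreq (hev.mono fun r hr => hr)
  intro t ht
  exact congrArg Prod.fst (hself t (hsub ht))

/-- Linear isometries preserve the Levi-Civita connection. -/
theorem christoffel_map_of_isometry [FiniteDimensional ℝ E] {Ω : Set E} (hΩ : IsOpen Ω)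
    {g : E → E →L[ℝ] E →L[ℝ] ℝ} (hg : IsRiemannianMetricOn Ω g) (L : E ≃L[ℝ] E)
    (hLΩ : MapsTo L Ω Ω) (hL : ∀ x ∈ Ω, ∀ u v, g (L x) (L u) (L v) = g x u v) {x : E}
    (hx : x ∈ Ω) (u v : E) : christoffel g (L x) (L u) (L v) = L (christoffel g x u v) := by
  have hd : ∀ y ∈ Ω, DifferentiableAt ℝ g y := fun y hy =>
    (hg.contDiffAt hΩ hy).differentiableAt (by simp)
  -- differentiate the identity `g (L y) (L v) (L w) = g y v w` in `y`
  have hfd : ∀ u v w, fderiv ℝ g (L x) (L u) (L v) (L w) = fderiv ℝ g x u v w := by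
    intro u v w
    have h1 : HasFDerivAt (fun y => g y v w) _ x :=
      ((hd x hx).hasFDerivAt.clm_apply (hasFDerivAt_const v x)).clm_apply (hasFDerivAt_const w x)
    have h2 : HasFDerivAt (fun y => g (L y) (L v) (L w)) _ x :=
      (((hd (L x) (hLΩ hx)).hasFDerivAt.comp x L.hasFDerivAt).clm_apply
        (hasFDerivAt_const (L v) x)).clm_apply (hasFDerivAt_const (L w) x)
    have h3 : (fun y => g (L y) (L v) (L w)) =ᶠ[𝓝 x] fun y => g y v w :=
      (hΩ.eventually_mem hx).mono fun y hy => hL y hy v w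
    have h4 := congrArg (fun T : E →L[ℝ] ℝ => T u) ((h2.congr_of_eventuallyEq h3.symm).unique h1)
    simpa using h4
  have hinj : Function.Injective (g (L x)) := (hg.isInvertible (hLΩ hx)).injective
  apply hinj
  ext w
  obtain ⟨w, rfl⟩ := L.surjective w
  rw [hg.apply_christoffel (hLΩ hx), hL x hx, hg.apply_christoffel hx, hfd, hfd, hfd]

theorem ContinuousLinearEquiv.deriv_comp_apply (L : E ≃L[ℝ] E) (c : ℝ → E) (t : ℝ) :
    deriv (fun r => L (c r)) t = L (deriv c t) := by
  rw [← fderiv_apply_one_eq_deriv, ← fderiv_apply_one_eq_deriv]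
  exact congrArg (fun T : ℝ →L[ℝ] E => T 1) (L.comp_fderiv (f := c) (x := t))

theorem IsGeodesicOn.map_of_isometry [FiniteDimensional ℝ E] {Ω : Set E} (hΩ : IsOpen Ω)
    {g : E → E →L[ℝ] E →L[ℝ] ℝ} (hg : IsRiemannianMetricOn Ω g) (L : E ≃L[ℝ] E)
    (hLΩ : MapsTo L Ω Ω) (hL : ∀ x ∈ Ω, ∀ u v, g (L x) (L u) (L v) = g x u v) {γ : ℝ → E}
    {a b : ℝ} (hγ : IsGeodesicOn Ω g γ a b) : IsGeodesicOn Ω g (fun t => L (γ t)) a b := by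
  have hcomp : deriv (fun t => L (γ t)) = fun t => L (deriv γ t) :=
    funext fun t => L.deriv_comp_apply γ t
  have hcomp2 : deriv (fun t => L (deriv γ t)) = fun t => L (deriv (deriv γ) t) :=
    funext fun t => L.deriv_comp_apply (deriv γ) t
  refine ⟨fun t ht => hLΩ (hγ.mem t ht), L.contDiff.comp_contDiffOn hγ.smooth, fun t ht => ?_⟩
  rw [hcomp, hcomp2]
  simp only
  rw [christoffel_map_of_isometry hΩ hg L hLΩ hL (hγ.mem t ht), ← map_add, hγ.equation t ht,
    map_zero]

/-- A geodesic whose position and velocity at one time are fixed by a linear isometry consists of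
fixed points of that isometry. -/
theorem IsGeodesicOn.map_eq_self_of_isometry [FiniteDimensional ℝ E] {Ω : Set E} (hΩ : IsOpen Ω)
    {g : E → E →L[ℝ] E →L[ℝ] ℝ} (hg : IsRiemannianMetricOn Ω g) (L : E ≃L[ℝ] E)
    (hLΩ : MapsTo L Ω Ω) (hL : ∀ x ∈ Ω, ∀ u v, g (L x) (L u) (L v) = g x u v) {γ : ℝ → E}
    {a b s : ℝ} (hγ : IsGeodesicOn Ω g γ a b) (hs : s ∈ Ioo a b) (h0 : L (γ s) = γ s)
    (h1 : L (deriv γ s) = deriv γ s) {t : ℝ} (ht : t ∈ Ioo a b) : L (γ t) = γ t :=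
  (hγ.map_of_isometry hΩ hg L hLΩ hL).eqOn hΩ hg hγ hs h0 ((L.deriv_comp_apply γ s).trans h1) ht

/-- A metric with constant coefficients is flat. -/
theorem riemannCurvature_eq_zero_of_const {g : E → E →L[ℝ] E →L[ℝ] ℝ} {B : E →L[ℝ] E →L[ℝ] ℝ}
    (hg : ∀ x, g x = B) (x u v w : E) : riemannCurvature g x u v w = 0 := by
  obtain rfl : g = fun _ => B := funext hg
  have h : ∀ x u v : E, christoffel (fun _ => B) x u v = 0 := by
    intro x u v
    simp [christoffel]
  simp [riemannCurvature, h]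

end Geodesics

/-! ### The Cartan subalgebras of diagonal matrices -/

section Cartan

attribute [local instance 100] LieRing.ofAssociativeRing

variable {𝕜 : Type*} [RCLike 𝕜] {n : ℕ}

theorem mem_tracelessDiag_iff {X : Matrix (Fin n) (Fin n) 𝕜} :
    X ∈ tracelessDiag 𝕜 n ↔ X.IsDiag ∧ X.trace = 0 := by
  constructor
  · rintro ⟨Y, hY, rfl⟩
    exact ⟨hY, Y.2⟩
  · rintro ⟨hX, htr⟩
    exact ⟨⟨X, htr⟩, hX, rfl⟩

theorem mem_cartanGL_iff {X : Matrix (Fin n) (Fin n) 𝕜} : X ∈ cartanGL 𝕜 n ↔ X.IsDiag := by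
  refine ⟨fun hX => isDiag_of_mem_sup 𝕜 n hX, fun hX => ?_⟩
  -- split off the multiple of the identity with the same trace; for `n = 0` the junk value of
  -- the quotient is harmless, every trace being `0`
  refine Submodule.mem_sup.2 ⟨(X.trace / n) • 1, Submodule.smul_mem _ _
    (Submodule.mem_span_singleton_self _), X - (X.trace / n) • 1, ?_, by abel⟩
  refine mem_tracelessDiag_iff.2 ⟨hX.sub (Matrix.isDiag_one.smul _), ?_⟩
  rcases Nat.eq_zero_or_pos n with rfl | hn
  · simp [Matrix.trace]
  · have : (n : 𝕜) ≠ 0 := by exact_mod_cast hn.ne'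
    simp [this]

theorem disjoint_span_one_tracelessDiag :
    Disjoint (Submodule.span 𝕜 {1}) (tracelessDiag 𝕜 n) := by
  rw [Submodule.disjoint_def]
  intro X hX hX'
  obtain ⟨c, rfl⟩ := Submodule.mem_span_singleton.1 hX
  have htr := (mem_tracelessDiag_iff.1 hX').2
  rcases Nat.eq_zero_or_pos n with rfl | hn
  · exact Subsingleton.elim _ _
  · have : (n : 𝕜) ≠ 0 := by exact_mod_cast hn.ne'
    have hc : c = 0 := by simpa [this] using htr
    simp [hc]

theorem lie_eq_zero_of_isDiag {X Y : Matrix (Fin n) (Fin n) 𝕜} (hX : X.IsDiag) (hY : Y.IsDiag) :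
    ⁅X, Y⁆ = 0 := by
  rw [← (Matrix.isDiag_iff_diagonal_diag X).1 hX, ← (Matrix.isDiag_iff_diagonal_diag Y).1 hY,
    Ring.lie_def]
  simp [mul_comm]

/-- Bracketing with `E_ii - E_jj` doubles the `(i, j)` entry, up to sign. Hence the diagonal
matrices of trace zero already detect whether a matrix normalizes the diagonal ones. -/
theorem isDiag_of_forall_isDiag_lie {X : Matrix (Fin n) (Fin n) 𝕜}
    (h : ∀ D : Matrix (Fin n) (Fin n) 𝕜, D.IsDiag → D.trace = 0 → ⁅X, D⁆.IsDiag) : X.IsDiag := by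
  intro i j hij
  let d : Fin n → 𝕜 := Pi.single i 1 - Pi.single j 1
  have hd := h (Matrix.diagonal d) (Matrix.isDiag_diagonal d) (by simp [d, Matrix.trace_diagonal]) hij
  have h2 : X i j * (-1) - X i j = 0 := by
    simpa [Ring.lie_def, d, hij, hij.symm] using hd
  linear_combination (-1 / 2 : 𝕜) * h2

theorem isCartanSubalgebra_diagSL : (diagSL 𝕜 n).IsCartanSubalgebra := by
  have hab : IsLieAbelian (diagSL 𝕜 n) :=
    ⟨fun X Y => Subtype.ext (Subtype.ext (lie_eq_zero_of_isDiag X.2 Y.2))⟩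
  refine ⟨inferInstance, le_antisymm (fun X hX => ?_) (LieSubalgebra.le_normalizer _)⟩
  refine isDiag_of_forall_isDiag_lie fun D hD htr => ?_
  exact (LieSubalgebra.mem_normalizer_iff _ X).1 hX
    ⟨D, htr⟩ hD

theorem isCartanSubalgebraOfGL_cartanGL : IsCartanSubalgebraOfGL (cartanGL 𝕜 n) := by
  have hab : IsLieAbelian (cartanGL 𝕜 n) :=
    ⟨fun X Y => Subtype.ext
      (lie_eq_zero_of_isDiag (mem_cartanGL_iff.1 X.2) (mem_cartanGL_iff.1 Y.2))⟩
  refine ⟨inferInstance, le_antisymm (fun X hX => ?_) (LieSubalgebra.le_normalizer _)⟩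
  refine mem_cartanGL_iff.2 (isDiag_of_forall_isDiag_lie fun D hD _ => ?_)
  exact mem_cartanGL_iff.1
    ((LieSubalgebra.mem_normalizer_iff _ X).1 hX D (mem_cartanGL_iff.2 hD))

end Cartan

/-! ### Coordinates on the Hermitian matrices -/

section Herm

variable {𝕜 : Type*} [RCLike 𝕜] {n : ℕ}

theorem hermIncl_injective : Function.Injective (hermIncl 𝕜 n) := fun _ _ h => Subtype.ext h

instance : FiniteDimensional ℝ (Herm 𝕜 n) :=
  Module.Finite.of_injective (hermIncl 𝕜 n) hermIncl_injective

/-- The `(i, j)` entry, as a continuous linear map. -/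
noncomputable def entryCLM (i j : Fin n) : Herm 𝕜 n →L[ℝ] 𝕜 :=
  LinearMap.toContinuousLinearMap (Matrix.entryLinearMap ℝ 𝕜 i j ∘ₗ hermIncl 𝕜 n)

/-- The real diagonal matrix with given diagonal, as a Hermitian matrix over `𝕜`. -/
noncomputable def diagHerm (𝕜 : Type*) [RCLike 𝕜] (n : ℕ) :
    EuclideanSpace ℝ (Fin n) →L[ℝ] Herm 𝕜 n :=
  LinearMap.toContinuousLinearMap
    { toFun := fun d => ⟨Matrix.diagonal fun i => (d i : 𝕜), by
        change (Matrix.diagonal fun i => (d i : 𝕜))ᴴ = _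
        rw [Matrix.diagonal_conjTranspose]
        congr 1
        ext i
        simp⟩
      map_add' := fun c d => Subtype.ext <| by
        change Matrix.diagonal _ = Matrix.diagonal _ + Matrix.diagonal _
        rw [Matrix.diagonal_add]
        simp
      map_smul' := fun c d => Subtype.ext <| by
        change Matrix.diagonal _ = c • Matrix.diagonal _
        rw [← Matrix.diagonal_smul]
        congr 1
        ext i
        simp [RCLike.real_smul_eq_coe_mul] }

theorem diagHerm_val (d : EuclideanSpace ℝ (Fin n)) :
    (diagHerm 𝕜 n d).1 = Matrix.diagonal fun i => (d i : 𝕜) := rfl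

theorem eq_diagHerm_of_isDiag {S : Herm 𝕜 n} (hS : S.1.IsDiag) :
    S = diagHerm 𝕜 n (WithLp.toLp 2 fun i => RCLike.re (S.1 i i)) := by
  refine Subtype.ext ?_
  rw [diagHerm_val, ← (Matrix.isDiag_iff_diagonal_diag S.1).1 hS]
  congr 1
  ext i
  have hS' : S.1.IsHermitian := S.2
  simpa using (hS'.coe_re_apply_self i).symm

theorem diagHerm_mem_posDefCone_iff {d : EuclideanSpace ℝ (Fin n)} :
    diagHerm 𝕜 n d ∈ posDefCone 𝕜 n ↔ ∀ i, 0 < d i := by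
  change (Matrix.diagonal fun i => (d i : 𝕜)).PosDef ↔ _
  rw [Matrix.posDef_diagonal_iff]
  simp

theorem isOpen_posDefCone : IsOpen (posDefCone 𝕜 n) := by
  rw [isOpen_iff_mem_nhds]
  intro S hS
  -- by homogeneity positivity has to be tested on the compact unit sphere only
  have hq : Continuous fun p : Herm 𝕜 n × (Fin n → 𝕜) =>
      RCLike.re (star p.2 ⬝ᵥ (p.1.1.mulVec p.2)) := by
    have he : ∀ i j, Continuous fun p : Herm 𝕜 n × (Fin n → 𝕜) => p.1.1 i j := fun i j =>
      (entryCLM i j).continuous.comp continuous_fst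
    have hx : ∀ i, Continuous fun p : Herm 𝕜 n × (Fin n → 𝕜) => p.2 i := fun i =>
      (continuous_apply i).comp continuous_snd
    have hm : ∀ i, Continuous fun p : Herm 𝕜 n × (Fin n → 𝕜) => p.1.1.mulVec p.2 i := fun i => by
      change Continuous fun p : Herm 𝕜 n × (Fin n → 𝕜) => ∑ j, p.1.1 i j * p.2 j
      exact continuous_finsetSum _ fun j _ => (he i j).mul (hx j)
    refine RCLike.continuous_re.comp ?_
    change Continuous fun p : Herm 𝕜 n × (Fin n → 𝕜) => ∑ i, star (p.2 i) * p.1.1.mulVec p.2 i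
    exact continuous_finsetSum _ fun i _ => (continuous_star.comp (hx i)).mul (hm i)
  have hev : ∀ᶠ T in 𝓝 S, ∀ x ∈ Metric.sphere (0 : Fin n → 𝕜) 1,
      0 < RCLike.re (star x ⬝ᵥ (T.1.mulVec x)) := by
    refine (isCompact_sphere 0 1).eventually_forall_of_forall_eventually fun x hx => ?_
    refine hq.continuousAt.eventually (lt_mem_nhds (?_ : (0 : ℝ) < _))
    have hx0 : x ≠ 0 := by
      rintro rfl
      simp at hx
    exact (RCLike.pos_iff.1 (Matrix.PosDef.dotProduct_mulVec_pos hS hx0)).1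
  filter_upwards [hev] with T hT
  have hTh : T.1.IsHermitian := T.2
  refine Matrix.PosDef.of_dotProduct_mulVec_pos hTh fun x hx => ?_
  refine RCLike.pos_iff.2 ⟨?_, hTh.im_star_dotProduct_mulVec_self x⟩
  have hn : 0 < ‖x‖ := norm_pos_iff.2 hx
  have h := hT ((‖x‖⁻¹ : 𝕜) • x) (by simp [norm_smul, hn.ne'])
  have h2 : star ((‖x‖⁻¹ : 𝕜) • x) ⬝ᵥ (T.1.mulVec ((‖x‖⁻¹ : 𝕜) • x)) =
      ((‖x‖⁻¹ ^ 2 : ℝ) : 𝕜) * (star x ⬝ᵥ T.1.mulVec x) := by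
    simp [Matrix.mulVec_smul, pow_two, mul_assoc]
  rw [h2, RCLike.re_ofReal_mul] at h
  exact pos_of_mul_pos_right h (by positivity)

end Herm

/-! ### The set of exponentials of diagonal matrices -/

section ExpCartan

variable {𝕜 : Type*} [RCLike 𝕜] {n : ℕ}

/-- The coordinates `t ↦ diag (exp t₁, …, exp tₙ)` on `expCartan 𝕜 n`. -/
noncomputable def expDiag (𝕜 : Type*) [RCLike 𝕜] (n : ℕ) (t : EuclideanSpace ℝ (Fin n)) :
    Herm 𝕜 n :=
  diagHerm 𝕜 n (WithLp.toLp 2 fun i => Real.exp (t i))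

theorem exp_diagonal_ofReal (t : Fin n → ℝ) :
    NormedSpace.exp (Matrix.diagonal fun i => (t i : 𝕜)) =
      Matrix.diagonal fun i => ((Real.exp (t i) : ℝ) : 𝕜) := by
  rw [Matrix.exp_diagonal]
  congr 1
  ext i
  rw [Pi.coe_exp, Real.exp_eq_exp_ℝ]
  exact (NormedSpace.algebraMap_exp_comm (𝕂 := ℝ) (𝔸 := 𝕜) (t i)).symm

theorem mem_expCartan_iff_isDiag_posDef {S : Herm 𝕜 n} :
    S ∈ expCartan 𝕜 n ↔ S.1.IsDiag ∧ S ∈ posDefCone 𝕜 n := by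
  constructor
  · rintro ⟨X, hX, hS⟩
    have hXd := (Matrix.isDiag_iff_diagonal_diag X).1 (mem_cartanGL_iff.1 hX)
    have hE : (NormedSpace.exp X).IsDiag := by
      rw [← hXd, Matrix.exp_diagonal]
      exact Matrix.isDiag_diagonal _
    have hunit : IsUnit (NormedSpace.exp X) := Matrix.isUnit_exp X
    refine ⟨?_, ?_⟩
    · rw [hS, ← (Matrix.isDiag_iff_diagonal_diag _).1 hE]
      simp
    · change S.1.PosDef
      rw [hS]
      exact Matrix.PosDef.mul_conjTranspose_self _ (Matrix.vecMul_injective_of_isUnit hunit)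
  · rintro ⟨hd, hpos⟩
    rw [eq_diagHerm_of_isDiag hd, diagHerm_mem_posDefCone_iff] at hpos
    -- the square root of a positive `s` is `exp (log s / 2)`
    refine ⟨Matrix.diagonal fun i => ((Real.log (RCLike.re (S.1 i i)) / 2 : ℝ) : 𝕜),
      mem_cartanGL_iff.2 (Matrix.isDiag_diagonal _), ?_⟩
    rw [exp_diagonal_ofReal fun i => Real.log (RCLike.re (S.1 i i)) / 2,
      Matrix.diagonal_conjTranspose, Matrix.diagonal_mul_diagonal]
    conv_lhs => rw [eq_diagHerm_of_isDiag hd, diagHerm_val]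
    congr 1
    ext i
    have : 0 < RCLike.re (S.1 i i) := hpos i
    simp only [Pi.star_apply, RCLike.star_def, RCLike.conj_ofReal]
    rw [← RCLike.ofReal_mul, ← Real.exp_add, add_halves, Real.exp_log this]

theorem expDiag_mem_expCartan (t : EuclideanSpace ℝ (Fin n)) : expDiag 𝕜 n t ∈ expCartan 𝕜 n :=
  mem_expCartan_iff_isDiag_posDef.2
    ⟨Matrix.isDiag_diagonal _, diagHerm_mem_posDefCone_iff.2 fun i => Real.exp_pos (t i)⟩

/-- The logarithms of the diagonal entries; on `expCartan 𝕜 n` this is the inverse of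
`expDiag 𝕜 n`. -/
noncomputable def logDiag (S : Herm 𝕜 n) : EuclideanSpace ℝ (Fin n) :=
  WithLp.toLp 2 fun i => Real.log (RCLike.re (S.1 i i))

theorem logDiag_expDiag (t : EuclideanSpace ℝ (Fin n)) : logDiag (expDiag 𝕜 n t) = t := by
  ext i
  simp [logDiag, expDiag, diagHerm_val]

theorem re_apply_self_pos_of_mem_expCartan {S : Herm 𝕜 n} (hS : S ∈ expCartan 𝕜 n) (i : Fin n) :
    0 < RCLike.re (S.1 i i) := by
  obtain ⟨hd, hpos⟩ := mem_expCartan_iff_isDiag_posDef.1 hS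
  rw [eq_diagHerm_of_isDiag hd, diagHerm_mem_posDefCone_iff] at hpos
  exact hpos i

theorem expDiag_logDiag {S : Herm 𝕜 n} (hS : S ∈ expCartan 𝕜 n) : expDiag 𝕜 n (logDiag S) = S := by
  conv_rhs => rw [eq_diagHerm_of_isDiag (mem_expCartan_iff_isDiag_posDef.1 hS).1]
  unfold expDiag logDiag
  congr 2
  ext i
  exact Real.exp_log (re_apply_self_pos_of_mem_expCartan hS i)

theorem range_expDiag : range (expDiag 𝕜 n) = expCartan 𝕜 n :=
  Subset.antisymm (range_subset_iff.2 expDiag_mem_expCartan)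
    fun S hS => ⟨logDiag S, expDiag_logDiag hS⟩

theorem expDiag_val (t : EuclideanSpace ℝ (Fin n)) :
    (expDiag 𝕜 n t).1 = NormedSpace.exp (Matrix.diagonal fun i => (t i : 𝕜)) :=
  (exp_diagonal_ofReal fun i => t i).symm

theorem hermIncl_image_expCartan :
    hermIncl 𝕜 n '' expCartan 𝕜 n =
      NormedSpace.exp '' {X : Matrix (Fin n) (Fin n) 𝕜 | X ∈ cartanGL 𝕜 n ∧ X.IsHermitian} := by
  ext M
  constructor
  · rintro ⟨S, hS, rfl⟩
    refine ⟨(diagHerm 𝕜 n (logDiag S)).1, ⟨mem_cartanGL_iff.2 (Matrix.isDiag_diagonal _),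
      (diagHerm 𝕜 n (logDiag S)).2⟩, ?_⟩
    exact (expDiag_val _).symm.trans (congrArg Subtype.val (expDiag_logDiag hS))
  · rintro ⟨X, ⟨hX, hXh⟩, rfl⟩
    have hX' := eq_diagHerm_of_isDiag (S := (⟨X, hXh⟩ : Herm 𝕜 n)) (mem_cartanGL_iff.1 hX)
    refine ⟨_, expDiag_mem_expCartan _, (expDiag_val _).trans
      (congrArg NormedSpace.exp (congrArg Subtype.val hX').symm)⟩

theorem hermIncl_image_expCartan_of_star_eq (h : ∀ z : 𝕜, star z = z) :
    hermIncl 𝕜 n '' expCartan 𝕜 n =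
      NormedSpace.exp '' (cartanGL 𝕜 n : Set (Matrix (Fin n) (Fin n) 𝕜)) := by
  rw [hermIncl_image_expCartan]
  congr 1
  ext X
  refine ⟨fun hX => hX.1, fun hX => ⟨hX, ?_⟩⟩
  have hXd := (Matrix.isDiag_iff_diagonal_diag X).1 (mem_cartanGL_iff.1 hX)
  rw [← hXd]
  exact Matrix.isHermitian_diagonal_of_self_adjoint _ (funext fun i => h _)

end ExpCartan

/-! ### The action of the general linear group -/

section Congruence

variable {𝕜 : Type*} [RCLike 𝕜] {n : ℕ}

theorem congruence_val (A : GL (Fin n) 𝕜) (S : Herm 𝕜 n) :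
    (congruence A S).1 = A.1 * S.1 * A.1ᴴ := rfl

theorem congruence_mul (A B : GL (Fin n) 𝕜) (S : Herm 𝕜 n) :
    congruence (A * B) S = congruence A (congruence B S) := by
  refine Subtype.ext ?_
  simp only [congruence_val, Units.val_mul, Matrix.conjTranspose_mul, Matrix.mul_assoc]

theorem congruence_one (S : Herm 𝕜 n) : congruence (1 : GL (Fin n) 𝕜) S = S := by
  refine Subtype.ext ?_
  simp [congruence_val]

/-- The action of an element of `GL_n(𝕜)` as a continuous linear automorphism. -/
noncomputable def congruenceEquiv (A : GL (Fin n) 𝕜) : Herm 𝕜 n ≃L[ℝ] Herm 𝕜 n :=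
  LinearEquiv.toContinuousLinearEquiv
    { toFun := congruence A
      invFun := congruence A⁻¹
      map_add' := fun S T => Subtype.ext <| by
        change A.1 * (S.1 + T.1) * A.1ᴴ = A.1 * S.1 * A.1ᴴ + A.1 * T.1 * A.1ᴴ
        rw [Matrix.mul_add, Matrix.add_mul]
      map_smul' := fun c S => Subtype.ext <| by
        change A.1 * (c • S.1) * A.1ᴴ = c • (A.1 * S.1 * A.1ᴴ)
        rw [Matrix.mul_smul, Matrix.smul_mul]
      left_inv := fun S => by rw [← congruence_mul, inv_mul_cancel, congruence_one]
      right_inv := fun S => by rw [← congruence_mul, mul_inv_cancel, congruence_one] }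

theorem congruence_mem_posDefCone (A : GL (Fin n) 𝕜) {S : Herm 𝕜 n} (hS : S ∈ posDefCone 𝕜 n) :
    congruence A S ∈ posDefCone 𝕜 n :=
  Matrix.PosDef.mul_mul_conjTranspose_same hS (Matrix.vecMul_injective_of_isUnit A.isUnit)

/-- The invertible diagonal matrix with the given nonzero real diagonal. -/
noncomputable def diagGL (𝕜 : Type*) [RCLike 𝕜] {n : ℕ} (d : Fin n → ℝ) (hd : ∀ i, d i ≠ 0) :
    GL (Fin n) 𝕜 where
  val := Matrix.diagonal fun i => (d i : 𝕜)
  inv := Matrix.diagonal fun i => (d i : 𝕜)⁻¹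
  val_inv := by
    have : ∀ i, (d i : 𝕜) ≠ 0 := fun i => by exact_mod_cast hd i
    simp [this]
  inv_val := by
    have : ∀ i, (d i : 𝕜) ≠ 0 := fun i => by exact_mod_cast hd i
    simp [this]

theorem congruence_diagGL_apply (d : Fin n → ℝ) (hd : ∀ i, d i ≠ 0) (S : Herm 𝕜 n)
    (i j : Fin n) : (congruence (diagGL 𝕜 d hd) S).1 i j = d i * S.1 i j * d j := by
  simp [congruence_val, diagGL, Matrix.diagonal_conjTranspose]

theorem congruence_diagGL_diagHerm (d : Fin n → ℝ) (hd : ∀ i, d i ≠ 0)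
    (u : EuclideanSpace ℝ (Fin n)) : congruence (diagGL 𝕜 d hd) (diagHerm 𝕜 n u) =
      diagHerm 𝕜 n (WithLp.toLp 2 fun i => d i * d i * u i) := by
  refine Subtype.ext ?_
  ext i j
  rw [congruence_diagGL_apply, diagHerm_val, diagHerm_val]
  rcases eq_or_ne i j with rfl | hij
  · simp
    ring
  · simp [hij]

end Congruence

/-! ### The trace metric -/

section TraceMetric

variable {𝕜 : Type*} [RCLike 𝕜] {n : ℕ}

/-- The bilinear form `(X, Y) ↦ Re tr (S⁻¹ X S⁻¹ Y)`. -/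
noncomputable def traceMetric (𝕜 : Type*) [RCLike 𝕜] (n : ℕ) (S : Herm 𝕜 n) :
    Herm 𝕜 n →L[ℝ] Herm 𝕜 n →L[ℝ] ℝ :=
  LinearMap.toContinuousBilinearMap <| LinearMap.mk₂ ℝ
    (fun X Y : Herm 𝕜 n => RCLike.re (S.1⁻¹ * X.1 * S.1⁻¹ * Y.1).trace)
    (fun X X' Y => by
      change RCLike.re (S.1⁻¹ * (X.1 + X'.1) * S.1⁻¹ * Y.1).trace = _
      simp only [Matrix.mul_add, Matrix.add_mul, Matrix.trace_add, map_add])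
    (fun c X Y => by
      change RCLike.re (S.1⁻¹ * (c • X.1) * S.1⁻¹ * Y.1).trace = _
      simp only [Matrix.mul_smul, Matrix.smul_mul, Matrix.trace_smul, RCLike.smul_re, smul_eq_mul])
    (fun X Y Y' => by
      change RCLike.re (S.1⁻¹ * X.1 * S.1⁻¹ * (Y.1 + Y'.1)).trace = _
      simp only [Matrix.mul_add, Matrix.trace_add, map_add])
    (fun c X Y => by
      change RCLike.re (S.1⁻¹ * X.1 * S.1⁻¹ * (c • Y.1)).trace = _
      simp only [Matrix.mul_smul, Matrix.trace_smul, RCLike.smul_re, smul_eq_mul])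

theorem traceMetric_apply (S X Y : Herm 𝕜 n) :
    traceMetric 𝕜 n S X Y = RCLike.re (S.1⁻¹ * X.1 * S.1⁻¹ * Y.1).trace := rfl

theorem ContDiff.matrix_det {F : Type*} [NormedAddCommGroup F] [NormedSpace ℝ F]
    {M : F → Matrix (Fin n) (Fin n) 𝕜} (hM : ∀ i j, ContDiff ℝ ∞ fun x => M x i j) :
    ContDiff ℝ ∞ fun x => (M x).det := by
  simp only [Matrix.det_apply, Units.smul_def, zsmul_eq_mul]
  exact ContDiff.sum fun σ _ => contDiff_const.mul (contDiff_prod fun i _ => hM _ _)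

theorem contDiffOn_inv_apply (i j : Fin n) :
    ContDiffOn ℝ ∞ (fun S : Herm 𝕜 n => S.1⁻¹ i j) (posDefCone 𝕜 n) := by
  have hdet : ContDiff ℝ ∞ fun S : Herm 𝕜 n => S.1.det :=
    ContDiff.matrix_det fun k l => (entryCLM (𝕜 := 𝕜) k l).contDiff
  have hadj : ContDiff ℝ ∞ fun S : Herm 𝕜 n => S.1.adjugate i j := by
    simp only [Matrix.adjugate_apply]
    refine ContDiff.matrix_det fun k l => ?_
    by_cases hk : k = j
    · subst hk
      simpa using contDiff_const
    · simp only [Matrix.updateRow_apply, hk, if_false]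
      exact (entryCLM (𝕜 := 𝕜) k l).contDiff
  have hne : ∀ S ∈ posDefCone 𝕜 n, S.1.det ≠ 0 := fun S hS =>
    ((Matrix.isUnit_iff_isUnit_det _).1 (Matrix.PosDef.isUnit hS)).ne_zero
  refine ((hdet.contDiffOn.inv hne).mul hadj.contDiffOn).congr fun S hS => ?_
  simp [Matrix.inv_def]

theorem contDiffOn_traceMetric : ContDiffOn ℝ ∞ (traceMetric 𝕜 n) (posDefCone 𝕜 n) := by
  refine contDiffOn_clm_apply.2 fun X => contDiffOn_clm_apply.2 fun Y => ?_
  simp only [traceMetric_apply, Matrix.trace, Matrix.diag_apply, Matrix.mul_apply]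
  refine (RCLike.reCLM (K := 𝕜)).contDiff.comp_contDiffOn ?_
  exact ContDiffOn.sum fun i _ => ContDiffOn.sum fun j _ =>
    (ContDiffOn.sum fun k _ => (ContDiffOn.sum fun l _ =>
      (contDiffOn_inv_apply i l).mul contDiffOn_const).mul
        (contDiffOn_inv_apply k j)).mul contDiffOn_const

open scoped MatrixOrder in
theorem traceMetric_self_pos {S : Herm 𝕜 n} (hS : S ∈ posDefCone 𝕜 n) {X : Herm 𝕜 n}
    (hX : X ≠ 0) : 0 < traceMetric 𝕜 n S X X := by
  have hT : S.1⁻¹.PosDef := Matrix.PosDef.inv hS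
  -- with `S⁻¹ = Yᴴ Y` the form is the squared Frobenius norm of the Hermitian matrix `Y X Yᴴ`
  obtain ⟨Y, hY⟩ := CStarAlgebra.nonneg_iff_eq_star_mul_self.mp hT.posSemidef.nonneg
  rw [Matrix.star_eq_conjTranspose] at hY
  have hYdet : IsUnit Y.det := by
    have h := (Matrix.isUnit_iff_isUnit_det _).1 hT.isUnit
    rw [hY, Matrix.det_mul] at h
    exact isUnit_of_mul_isUnit_right h
  have hYu : IsUnit Y := (Matrix.isUnit_iff_isUnit_det _).2 hYdet
  have hXh : X.1ᴴ = X.1 := X.2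
  set Z := Y * X.1 * Yᴴ with hZ
  have htr : (S.1⁻¹ * X.1 * S.1⁻¹ * X.1).trace = (Zᴴ * Z).trace := by
    rw [hY, hZ]
    simp only [Matrix.conjTranspose_mul, Matrix.conjTranspose_conjTranspose, hXh,
      Matrix.mul_assoc]
    rw [Matrix.trace_mul_comm]
    simp only [Matrix.mul_assoc]
  have hZ0 : Z ≠ 0 := by
    intro h
    apply hX
    refine Subtype.ext ?_
    change X.1 = 0
    rw [hZ, Matrix.mul_assoc] at h
    have h1 : X.1 * Yᴴ = 0 := hYu.mul_right_eq_zero.1 h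
    exact (hYu.star).mul_left_eq_zero.1 h1
  have hnn : 0 ≤ (Zᴴ * Z).trace := (Matrix.posSemidef_conjTranspose_mul_self Z).trace_nonneg
  have hne : (Zᴴ * Z).trace ≠ 0 := fun h =>
    hZ0 (Matrix.trace_conjTranspose_mul_self_eq_zero_iff.1 h)
  rw [traceMetric_apply, htr]
  exact (RCLike.pos_iff.1 (lt_of_le_of_ne hnn hne.symm)).1

theorem isRiemannianMetricOn_traceMetric :
    IsRiemannianMetricOn (posDefCone 𝕜 n) (traceMetric 𝕜 n) where
  smooth := contDiffOn_traceMetric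
  symm S _ X Y := by
    rw [traceMetric_apply, traceMetric_apply, Matrix.mul_assoc (S.1⁻¹ * X.1),
      Matrix.trace_mul_comm, ← Matrix.mul_assoc]
  pos _ hS _ hX := traceMetric_self_pos hS hX

theorem isInvariantMetric_traceMetric : IsInvariantMetric (traceMetric 𝕜 n) := by
  intro A S _ X Y
  have hA : IsUnit A.1.det := (Matrix.isUnit_iff_isUnit_det _).1 A.isUnit
  have hA' : IsUnit A.1ᴴ.det := (Matrix.isUnit_iff_isUnit_det _).1 A.isUnit.star
  simp only [traceMetric_apply, congruence_val, Matrix.mul_inv_rev]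
  have h : A.1ᴴ⁻¹ * (S.1⁻¹ * A.1⁻¹) * (A.1 * X.1 * A.1ᴴ) * (A.1ᴴ⁻¹ * (S.1⁻¹ * A.1⁻¹)) *
      (A.1 * Y.1 * A.1ᴴ) = A.1ᴴ⁻¹ * (S.1⁻¹ * X.1 * S.1⁻¹ * Y.1) * A.1ᴴ := by
    simp only [Matrix.mul_assoc, Matrix.nonsing_inv_mul_cancel_left _ _ hA,
      Matrix.mul_nonsing_inv_cancel_left _ _ hA']
  rw [h, Matrix.trace_mul_comm, Matrix.mul_nonsing_inv_cancel_left _ _ hA']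

end TraceMetric

/-! ### The flat -/

section Flat

variable {𝕜 : Type*} [RCLike 𝕜] {n : ℕ}

theorem contDiff_toLp_exp : ContDiff ℝ ∞ fun t : EuclideanSpace ℝ (Fin n) =>
    (WithLp.toLp 2 fun i => Real.exp (t i) : EuclideanSpace ℝ (Fin n)) :=
  contDiff_euclidean.2 fun i => Real.contDiff_exp.comp (EuclideanSpace.proj (𝕜 := ℝ) i).contDiff

theorem fderiv_expDiag (t u : EuclideanSpace ℝ (Fin n)) :
    fderiv ℝ (expDiag 𝕜 n) t u = diagHerm 𝕜 n (WithLp.toLp 2 fun i => Real.exp (t i) * u i) := by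
  have hd := (contDiff_toLp_exp (n := n)).differentiable (by simp) t
  have h1 : fderiv ℝ (expDiag 𝕜 n) t u =
      diagHerm 𝕜 n (fderiv ℝ (fun t : EuclideanSpace ℝ (Fin n) =>
        (WithLp.toLp 2 fun i => Real.exp (t i) : EuclideanSpace ℝ (Fin n))) t u) :=
    congrArg (fun T : EuclideanSpace ℝ (Fin n) →L[ℝ] Herm 𝕜 n => T u)
      ((diagHerm 𝕜 n).hasFDerivAt.comp t hd.hasFDerivAt).fderiv
  rw [h1]
  congr 1
  ext i
  let P : EuclideanSpace ℝ (Fin n) →L[ℝ] ℝ := EuclideanSpace.proj i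
  have h2 := P.hasFDerivAt.comp t hd.hasFDerivAt
  have h3 : HasFDerivAt (fun t : EuclideanSpace ℝ (Fin n) => Real.exp (t i))
      (Real.exp (t i) • P) t := P.hasFDerivAt.exp
  exact congrArg (fun T : EuclideanSpace ℝ (Fin n) →L[ℝ] ℝ => T u) (h2.unique h3)

theorem diagHerm_injective : Function.Injective (diagHerm 𝕜 n) := by
  intro c d h
  ext i
  have := congrArg (fun S : Herm 𝕜 n => S.1 i i) h
  simpa [diagHerm_val] using this

theorem isLocalParametrization_expDiag :
    IsLocalParametrization (expCartan 𝕜 n) (expDiag 𝕜 n) univ where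
  isOpen := isOpen_univ
  smooth := ((diagHerm 𝕜 n).contDiff.comp contDiff_toLp_exp).contDiffOn
  immersion t _ u v h := by
    rw [fderiv_expDiag, fderiv_expDiag] at h
    ext i
    have := congrArg (fun x : EuclideanSpace ℝ (Fin n) => x i) (diagHerm_injective h)
    simpa using this
  image_eq := ⟨univ, isOpen_univ, by rw [image_univ, range_expDiag, inter_univ]⟩
  inverse := by
    refine ⟨logDiag, ?_, fun t _ => logDiag_expDiag t⟩
    rw [image_univ, range_expDiag]
    refine (PiLp.continuous_toLp 2 _).comp_continuousOn (continuousOn_pi.2 fun i => ?_)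
    exact ContinuousOn.log (RCLike.continuous_re.comp (entryCLM i i).continuous).continuousOn
      fun S hS => (re_apply_self_pos_of_mem_expCartan hS i).ne'

theorem mem_image_expDiag {S : Herm 𝕜 n} (hS : S ∈ expCartan 𝕜 n) : S ∈ expDiag 𝕜 n '' univ := by
  rwa [image_univ, range_expDiag]

theorem isSubmanifold_expCartan : IsSubmanifold n (expCartan 𝕜 n) := fun _ hS =>
  ⟨expDiag 𝕜 n, univ, isLocalParametrization_expDiag, mem_image_expDiag hS⟩

/-- In the coordinates `expDiag` an invariant metric has constant coefficients, because
`diag (exp (tᵢ / 2))` carries the coordinate frame at `0` to the one at `t`. -/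
theorem pullbackMetric_expDiag {g : Herm 𝕜 n → Herm 𝕜 n →L[ℝ] Herm 𝕜 n →L[ℝ] ℝ}
    (hg : IsInvariantMetric g) (t : EuclideanSpace ℝ (Fin n)) :
    pullbackMetric g (expDiag 𝕜 n) t =
      (g (expDiag 𝕜 n 0)).bilinearComp (diagHerm 𝕜 n) (diagHerm 𝕜 n) := by
  ext u v
  let A : GL (Fin n) 𝕜 := diagGL 𝕜 (fun i => Real.exp (t i / 2)) fun i => (Real.exp_pos _).ne'
  have hA : ∀ w : EuclideanSpace ℝ (Fin n), congruence A (diagHerm 𝕜 n w) =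
      diagHerm 𝕜 n (WithLp.toLp 2 fun i => Real.exp (t i) * w i) := by
    intro w
    rw [congruence_diagGL_diagHerm]
    simp only [← Real.exp_add, add_halves]
  have h0 : congruence A (expDiag 𝕜 n 0) = expDiag 𝕜 n t := by
    unfold expDiag
    rw [hA]
    simp
  have h := hg A (expDiag 𝕜 n 0) (mem_expCartan_iff_isDiag_posDef.1 (expDiag_mem_expCartan 0)).2
    (diagHerm 𝕜 n u) (diagHerm 𝕜 n v)
  rw [h0, hA, hA] at h
  change g (expDiag 𝕜 n t) (fderiv ℝ (expDiag 𝕜 n) t u) (fderiv ℝ (expDiag 𝕜 n) t v) =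
    g (expDiag 𝕜 n 0) (diagHerm 𝕜 n u) (diagHerm 𝕜 n v)
  rw [fderiv_expDiag, fderiv_expDiag, h]

theorem isFlatSubmanifold_expCartan {g : Herm 𝕜 n → Herm 𝕜 n →L[ℝ] Herm 𝕜 n →L[ℝ] ℝ}
    (hg : IsInvariantMetric g) : IsFlatSubmanifold n g (expCartan 𝕜 n) := fun _ hS =>
  ⟨expDiag 𝕜 n, univ, isLocalParametrization_expDiag, mem_image_expDiag hS,
    fun t _ u v w => riemannCurvature_eq_zero_of_const (pullbackMetric_expDiag hg) t u v w⟩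

theorem isDiag_of_mem_tangentVectors {S X : Herm 𝕜 n} (hX : X ∈ tangentVectors (expCartan 𝕜 n) S) :
    X.1.IsDiag := by
  obtain ⟨c, -, hc, hmem, rfl⟩ := hX
  intro i j hij
  have hd : HasDerivAt c (deriv c 0) 0 := (hc.differentiableAt (by simp)).hasDerivAt
  have h1 : HasDerivAt (fun t => (c t).1 i j) ((deriv c 0).1 i j) 0 :=
    (entryCLM (𝕜 := 𝕜) i j).hasFDerivAt.comp_hasDerivAt 0 hd
  have h2 : (fun t => (c t).1 i j) =ᶠ[𝓝 0] fun _ => 0 :=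
    hmem.mono fun t ht => (mem_expCartan_iff_isDiag_posDef.1 ht).1 hij
  exact h1.unique ((hasDerivAt_const (0 : ℝ) (0 : 𝕜)).congr_of_eventuallyEq h2)

/-- The reflection in the `k`-th coordinate hyperplane. -/
noncomputable def reflectionGL (𝕜 : Type*) [RCLike 𝕜] {n : ℕ} (k : Fin n) : GL (Fin n) 𝕜 :=
  diagGL 𝕜 (fun i => if i = k then -1 else 1) fun i => by split_ifs <;> norm_num

/-- The diagonal matrices are the common fixed points of the coordinate reflections. -/
theorem isDiag_iff_forall_congruence_reflectionGL {S : Herm 𝕜 n} :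
    S.1.IsDiag ↔ ∀ k, congruence (reflectionGL 𝕜 k) S = S := by
  constructor
  · intro hS k
    refine Subtype.ext ?_
    ext i j
    rw [reflectionGL, congruence_diagGL_apply]
    rcases eq_or_ne i j with rfl | hij
    · split_ifs <;> simp
    · simp [hS hij]
  · intro h i j hij
    have hk : (congruence (reflectionGL 𝕜 i) S).1 i j = S.1 i j := by rw [h i]
    rw [reflectionGL, congruence_diagGL_apply] at hk
    have hk' : -S.1 i j = S.1 i j := by simpa [hij.symm] using hk
    linear_combination (-1 / 2 : 𝕜) * hk'

theorem isTotallyGeodesic_expCartan {g : Herm 𝕜 n → Herm 𝕜 n →L[ℝ] Herm 𝕜 n →L[ℝ] ℝ}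
    (hg : IsRiemannianMetricOn (posDefCone 𝕜 n) g) (hinv : IsInvariantMetric g) :
    IsTotallyGeodesic (posDefCone 𝕜 n) g (expCartan 𝕜 n) := by
  refine ⟨fun S hS => (mem_expCartan_iff_isDiag_posDef.1 hS).2,
    fun γ a b hγ s hs hγs hγs' t ht => mem_expCartan_iff_isDiag_posDef.2 ⟨?_, hγ.mem t ht⟩⟩
  have h0 := isDiag_iff_forall_congruence_reflectionGL.1 (mem_expCartan_iff_isDiag_posDef.1 hγs).1
  have h1 := isDiag_iff_forall_congruence_reflectionGL.1 (isDiag_of_mem_tangentVectors hγs')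
  exact isDiag_iff_forall_congruence_reflectionGL.2 fun k =>
    hγ.map_eq_self_of_isometry isOpen_posDefCone hg (congruenceEquiv (reflectionGL 𝕜 k))
      (fun S hS => congruence_mem_posDefCone _ hS) (hinv _) hs (h0 k) (h1 k) ht

end Flat

/-! ### Diagospectrahedra -/

section Spectrahedra

variable {𝕜 : Type*} [RCLike 𝕜] {n m : ℕ} {Q₀ : Herm 𝕜 n} {Q : Fin m → Herm 𝕜 n}

theorem continuous_pencil (Q₀ : Herm 𝕜 n) (Q : Fin m → Herm 𝕜 n) : Continuous (pencil Q₀ Q) :=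
  continuous_const.add (continuous_finsetSum _ fun i _ =>
    ((EuclideanSpace.proj (𝕜 := ℝ) i).continuous).smul continuous_const)

theorem IsDiagonalPencil.isDiag (hQ : IsDiagonalPencil Q₀ Q) (x : EuclideanSpace ℝ (Fin m)) :
    (pencil Q₀ Q x).1.IsDiag := by
  have h0 : ∀ S : Herm 𝕜 n, S.1.IsDiag ↔ ∀ i j, i ≠ j → entryCLM i j S = 0 := fun S =>
    ⟨fun h i j hij => h hij, fun h i j hij => h i j hij⟩
  rw [h0]
  intro i j hij
  have h1 : ∀ k, entryCLM i j (Q k) = 0 := fun k => hQ.2 k hij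
  have h2 : entryCLM i j Q₀ = 0 := hQ.1 hij
  rw [pencil, map_add, map_sum, h2]
  simp only [map_smul, h1, smul_zero, Finset.sum_const_zero, add_zero]

theorem pencil_lineMap (x y : EuclideanSpace ℝ (Fin m)) (c : ℝ) :
    pencil Q₀ Q (x + c • (x - y)) = (1 + c) • pencil Q₀ Q x - c • pencil Q₀ Q y := by
  simp only [pencil, PiLp.add_apply, PiLp.smul_apply, PiLp.sub_apply, smul_eq_mul, add_smul,
    mul_sub, sub_smul, smul_add, Finset.sum_add_distrib, Finset.sum_sub_distrib, Finset.smul_sum,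
    mul_smul, one_smul]
  abel

theorem interior_spectrahedron (hQ : IsDiagonalPencil Q₀ Q)
    (hpos : ∃ x, pencil Q₀ Q x ∈ posDefCone 𝕜 n) :
    interior (spectrahedron Q₀ Q) = pencil Q₀ Q ⁻¹' expCartan 𝕜 n := by
  have hpre : pencil Q₀ Q ⁻¹' expCartan 𝕜 n = pencil Q₀ Q ⁻¹' posDefCone 𝕜 n := by
    ext x
    exact mem_expCartan_iff_isDiag_posDef.trans (and_iff_right (hQ.isDiag x))
  rw [hpre]
  refine Subset.antisymm (fun x hx => ?_) (interior_maximal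
    (fun x hx => Matrix.PosDef.posSemidef hx) (isOpen_posDefCone.preimage (continuous_pencil Q₀ Q)))
  obtain ⟨y, hy⟩ := hpos
  -- the segment from `y` to `x` can be prolonged inside the spectrahedron a little beyond `x`
  have hcont : Tendsto (fun c : ℝ => x + c • (x - y)) (𝓝[>] 0) (𝓝 x) := by
    have : Continuous fun c : ℝ => x + c • (x - y) := by fun_prop
    simpa using (this.tendsto 0).mono_left nhdsWithin_le_nhds
  obtain ⟨c, hcS, hc⟩ := ((hcont.eventually (mem_interior_iff_mem_nhds.1 hx)).and
    self_mem_nhdsWithin).exists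
  have hc : 0 < c := hc
  have hcS : (pencil Q₀ Q (x + c • (x - y))).1.PosSemidef := hcS
  -- so `(1 + c) Q(x)` is a positive semidefinite matrix plus `c Q(y)`
  have hsum : pencil Q₀ Q x = (1 + c)⁻¹ • (pencil Q₀ Q (x + c • (x - y)) + c • pencil Q₀ Q y) := by
    rw [pencil_lineMap, sub_add_cancel, inv_smul_smul₀ (by positivity)]
  change (pencil Q₀ Q x).1.PosDef
  rw [hsum]
  change ((1 + c)⁻¹ • ((pencil Q₀ Q (x + c • (x - y))).1 + c • (pencil Q₀ Q y).1)).PosDef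
  exact Matrix.PosDef.smul (Matrix.PosDef.posSemidef_add hcS (Matrix.PosDef.smul hy hc))
    (by positivity)

theorem injective_pencil (hQ : LinearIndependent ℝ Q) : Function.Injective (pencil Q₀ Q) := by
  intro x y h
  ext i
  exact congrFun (hQ.fintypeLinearCombination_injective (add_left_cancel h)) i

end Spectrahedra

theorem mainTheorem6 {𝕜 : Type*} [RCLike 𝕜] (n : ℕ) :
    -- `𝔞` is a Cartan subalgebra of `sl_n`, and `𝔞~ = 𝕜 · Id ⊕ 𝔞` is one of `gl_n`
    (diagSL 𝕜 n).IsCartanSubalgebra ∧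
    IsCartanSubalgebraOfGL (cartanGL 𝕜 n) ∧
    Disjoint (Submodule.span 𝕜 {1}) (tracelessDiag 𝕜 n) ∧
    -- `exp 𝔞~` as a set of positive definite matrices
    hermIncl 𝕜 n '' expCartan 𝕜 n =
      NormedSpace.exp '' {X : Matrix (Fin n) (Fin n) 𝕜 | X ∈ cartanGL 𝕜 n ∧ X.IsHermitian} ∧
    ((∀ z : 𝕜, star z = z) →
      hermIncl 𝕜 n '' expCartan 𝕜 n = NormedSpace.exp '' (cartanGL 𝕜 n : Set (Matrix _ _ 𝕜))) ∧
    -- the trace metric is an invariant Riemannian metric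
    (∃ g : Herm 𝕜 n → Herm 𝕜 n →L[ℝ] Herm 𝕜 n →L[ℝ] ℝ,
      IsRiemannianMetricOn (posDefCone 𝕜 n) g ∧ IsInvariantMetric g ∧
      ∀ S ∈ posDefCone 𝕜 n, ∀ X Y : Herm 𝕜 n,
        g S X Y = RCLike.re (S.1⁻¹ * X.1 * S.1⁻¹ * Y.1).trace) ∧
    -- for every invariant Riemannian metric, `exp 𝔞~` is a flat totally geodesic submanifold
    (∀ g : Herm 𝕜 n → Herm 𝕜 n →L[ℝ] Herm 𝕜 n →L[ℝ] ℝ,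
      IsRiemannianMetricOn (posDefCone 𝕜 n) g → IsInvariantMetric g →
      IsSubmanifold n (expCartan 𝕜 n) ∧
      IsTotallyGeodesic (posDefCone 𝕜 n) g (expCartan 𝕜 n) ∧
      IsFlatSubmanifold n g (expCartan 𝕜 n)) ∧
    -- it parametrizes the interior of every strictly feasible diagospectrahedron
    (∀ (m : ℕ) (Q₀ : Herm 𝕜 n) (Q : Fin m → Herm 𝕜 n), IsDiagonalPencil Q₀ Q →
      (∃ x, pencil Q₀ Q x ∈ posDefCone 𝕜 n) →
      interior (spectrahedron Q₀ Q) = pencil Q₀ Q ⁻¹' expCartan 𝕜 n ∧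
      pencil Q₀ Q '' interior (spectrahedron Q₀ Q) = expCartan 𝕜 n ∩ range (pencil Q₀ Q) ∧
      (LinearIndependent ℝ Q → Function.Injective (pencil Q₀ Q)) ∧
      (LinearIndependent ℝ Q → (∀ D : Herm 𝕜 n, D.1.IsDiag → D ∈ range (pencil Q₀ Q)) →
        BijOn (pencil Q₀ Q) (interior (spectrahedron Q₀ Q)) (expCartan 𝕜 n))) := by
  refine ⟨isCartanSubalgebra_diagSL, isCartanSubalgebraOfGL_cartanGL,
    disjoint_span_one_tracelessDiag, hermIncl_image_expCartan, hermIncl_image_expCartan_of_star_eq,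
    ⟨traceMetric 𝕜 n, isRiemannianMetricOn_traceMetric, isInvariantMetric_traceMetric,
      fun S _ X Y => traceMetric_apply S X Y⟩,
    fun g hg hinv => ⟨isSubmanifold_expCartan, isTotallyGeodesic_expCartan hg hinv,
      isFlatSubmanifold_expCartan hinv⟩, fun m Q₀ Q hQ hpos => ?_⟩
  have himage : pencil Q₀ Q '' interior (spectrahedron Q₀ Q) =
      expCartan 𝕜 n ∩ range (pencil Q₀ Q) := by
    rw [interior_spectrahedron hQ hpos, image_preimage_eq_inter_range]
  refine ⟨interior_spectrahedron hQ hpos, himage, injective_pencil, fun hli hall => ?_⟩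
  have hrange : expCartan 𝕜 n ⊆ range (pencil Q₀ Q) := fun S hS =>
    hall S (mem_expCartan_iff_isDiag_posDef.1 hS).1
  have h := (injective_pencil (Q₀ := Q₀) hli).injOn.bijOn_image (s := interior (spectrahedron Q₀ Q))
  rwa [himage, inter_eq_left.2 hrange] at h
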